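/- All spaces are separable and metrizable. A locally compact space $X$ is an absolute retract (AR) if, whenever $X$ is embedded as a closed subset of a space $Y$, its image is a retract of $Y$. A closed subset $A$ of a space $X$ is a $\mathcal{Z}$-set if there is a homotopy $F: X\times[0,1]\to X$ with $F_0=\mathrm{id}_X$ and $F_t(X)\subseteq X-A$ for all $t>0$. An action of a group $G$ on a metric space $X$ is geometric if it is by isometries, proper (for every compact $K\subseteq X$ the set $\{g\in G: gK\cap K\neq\varnothing\}$ is finite) and cocompact ($GK=X$ for some compact $K\subseteq X$). Given a proper metric space $X$ (closed balls are compact) with a $G$-action, a $\mathcal{Z}$-structure $(\overline{X},Z)$ for $G$ compactifying $X$ consists of a compact AR $\overline{X}$ and a $\mathcal{Z}$-set $Z$ in $\overline{X}$ with $\overline{X}-Z=X$ (as topological spaces), such that the action of $G$ on $X$ is geometric and the nullity condition holds: for every compact $C\subseteq X$ and every open cover $\mathcal{U}$ of $\overline{X}$, all but finitely many $G$-translates of $C$ lie in an element of $\mathcal{U}$. Two groups are quasi-isometric if they are finitely generated and quasi-isometric with respect to the word metrics of finite generating sets. Theorem 1.4 (Generalized Boundary Swapping). Suppose quasi-isometric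 groups $G$ and $H$ act geometrically on proper metric ARs $X$ and $Y$, respectively, and $Y$ can be compactified to a $\mathcal{Z}$-structure $(\overline{Y},Z)$ for $H$. Then $X$ can be compactified, by addition of (a homeomorphic copy of) the same boundary $Z$, to a $\mathcal{Z}$-structure $(\overline{X},Z)$ for $G$. -/

import Mathlib

open Set Topology

universe u v w

/-- An absolute retract, in the category of separable metrizable spaces: a locally compact
(separable metrizable) space `X` such that, whenever `X` is embedded as a closed subset of a
separable metrizable space `Y`, its image is a retract of `Y`.  (Such an `X` is in particular an
absolute neighborhood retract, the whole of `Y` being the neighborhood that retracts.  A separable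
metrizable space is homeomorphic to a subspace of the Hilbert cube, so that the universe in which
`Y` ranges is immaterial.) -/
structure IsAR (X : Type u) [TopologicalSpace X] : Prop where
  metrizable : TopologicalSpace.MetrizableSpace X
  separable : TopologicalSpace.SeparableSpace X
  locallyCompact : LocallyCompactSpace X
  exists_retraction : ∀ (Y : Type u) [TopologicalSpace Y] [TopologicalSpace.MetrizableSpace Y]
    [TopologicalSpace.SeparableSpace Y] (e : X → Y), IsClosedEmbedding e →
      ∃ r : Y → X, Continuous r ∧ ∀ x, r (e x) = x

/-- A `𝒵`-set: a closed subset `A` of `X` for which there is a homotopy `F : X × [0,1] → X` with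
`F₀ = id` and `F_t(X) ⊆ X - A` for every `t > 0`. -/
def IsZSet {X : Type u} [TopologicalSpace X] (A : Set X) : Prop :=
  IsClosed A ∧ ∃ F : X × unitInterval → X, Continuous F ∧ (∀ x, F (x, 0) = x) ∧
    ∀ (x : X) (t : unitInterval), 0 < t → F (x, t) ∉ A

/-- A geometric action: by isometries, proper (i.e. for compact `K`, `L` only finitely many
`g` satisfy `gK ∩ L ≠ ∅`), and cocompact. -/
structure IsGeometricAction (G : Type v) [Group G] (X : Type u) [MetricSpace X] [MulAction G X] :
    Prop where
  isometric : IsIsometricSMul G X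
  properlyDiscontinuous : ProperlyDiscontinuousSMul G X
  cocompact : ∃ K : Set X, IsCompact K ∧ ∀ x : X, ∃ g : G, ∃ k ∈ K, g • k = x

/-- `(X̄, Z)` is a `𝒵`-structure on the group `G`, where `i : X → X̄` identifies the proper metric
space `X`, with the given action of `G`, with `X̄ - Z`. -/
structure IsZStructure (G : Type v) [Group G] {X : Type u} [MetricSpace X] [MulAction G X]
    {Xbar : Type w} [TopologicalSpace Xbar] (i : X → Xbar) (Z : Set Xbar) : Prop where
  compact : CompactSpace Xbar
  isAR : IsAR Xbar
  isZSet : IsZSet Z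
  isEmbedding : IsEmbedding i
  range_eq : range i = Zᶜ
  proper : ProperSpace X
  geometric : IsGeometricAction G X
  /-- The nullity condition: for every compact `C ⊆ X` and every open cover `𝒰` of `X̄`, all but
  finitely many `G`-translates of `C` lie in an element of `𝒰`. -/
  nullity : ∀ C : Set X, IsCompact C → ∀ 𝒰 : Set (Set Xbar), (∀ U ∈ 𝒰, IsOpen U) → ⋃₀ 𝒰 = univ →
    {g : G | ¬ ∃ U ∈ 𝒰, ∀ x ∈ C, i (g • x) ∈ U}.Finite

/-- The length of `g` with respect to the generating set `S`: the least length of a word in the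
letters `S ∪ S⁻¹` that represents `g`. -/
noncomputable def wordLength {G : Type v} [Group G] (S : Set G) (g : G) : ℕ :=
  sInf {n : ℕ | ∃ l : List G, (∀ s ∈ l, s ∈ S ∨ s⁻¹ ∈ S) ∧ l.prod = g ∧ l.length = n}

/-- The word metric with respect to the generating set `S`. -/
noncomputable def wordDist {G : Type v} [Group G] (S : Set G) (g h : G) : ℝ :=
  (wordLength S (g⁻¹ * h) : ℝ)

/-- Quasi-isometric groups: finitely generated groups that are quasi-isometric with respect to word
metrics of finite generating sets.  (Word metrics of two finite generating sets of the same group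
are quasi-isometric, so that the choice of the generating sets is immaterial.) -/
def QuasiIsometricGroups (G : Type v) (H : Type w) [Group G] [Group H] : Prop :=
  ∃ (S : Set G) (T : Set H), S.Finite ∧ Subgroup.closure S = ⊤ ∧ T.Finite ∧
    Subgroup.closure T = ⊤ ∧ ∃ (f : G → H) (K C : ℝ), 1 ≤ K ∧ 0 ≤ C ∧
      (∀ g g' : G, wordDist S g g' / K - C ≤ wordDist T (f g) (f g') ∧
        wordDist T (f g) (f g') ≤ K * wordDist S g g' + C) ∧
      ∀ h : H, ∃ g : G, wordDist T (f g) h ≤ C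

/-! ### Coarse maps between groups -/

section Groups

variable {G H : Type*} [Group G] [Group H]

/-! Word balls are finite, so a quasi-isometry yields coarse maps between the groups, hence between
orbits in `X` and `Y`. Cocompactness makes the extension property of an AR uniform over balls of a
given radius, so the orbit maps can be replaced by continuous bornologous maps `f : X → Y` and `f' :
Y → X`, with both composites at bounded distance from the identity and a bounded homotopy `h` from
the identity to `f' ∘ f` (`QuasiIsometricGroups.exists_continuous_equivalence`).

The new compactification is `T = X ⊔ Z`, where neighbourhoods of a boundary point are pulled back
along `p = f ∪ id : T → Ybar`. The nullity condition on `Ybar` says that bounded moves in `Y` become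
invisible near `Z` (`IsZStructure.exists_nhds_control`). Hence `f'` extends by the identity of `Z`
to `q : Ybar → T`, bounded homotopies of `X` extend to `T`, and nullity passes to `T`.

If `F` pushes `Ybar` off `Z`, then following `h` from `t` to `q (p t)` and continuing with `q ∘ F_s
∘ p` pushes `T` off its boundary. The time spent on `h` shrinks to zero at the boundary, so the push
is instantaneous there too. Finally, a compact metrizable space that deforms instantly into an AR is
an AR (`IsAR.of_homotopy`): a map on a larger space `W` follows the deformation up to a time that
tends to zero slowly as the point approaches `T`. -/

theorem finite_setOf_list_prod {S : Set G} (hS : S.Finite) (n : ℕ) :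
    {g : G | ∃ l : List G, (∀ s ∈ l, s ∈ S ∨ s⁻¹ ∈ S) ∧ l.prod = g ∧ l.length = n}.Finite := by
  induction n with
  | zero =>
    refine (finite_singleton (1 : G)).subset ?_
    rintro g ⟨l, -, rfl, h0⟩
    simp [List.length_eq_zero_iff.1 h0]
  | succ n ih =>
    refine (Finite.image2 (fun a b => a * b) (hS.union hS.inv) ih).subset ?_
    rintro g ⟨l, hl, rfl, hn⟩
    cases l with
    | nil => simp at hn
    | cons a l =>
      refine ⟨a, ?_, l.prod, ⟨l, fun s hs => hl s (List.mem_cons_of_mem _ hs), rfl, ?_⟩, ?_⟩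
      · simpa using hl a List.mem_cons_self
      · simpa using hn
      · simp

theorem finite_wordLength_le {S : Set G} (hS : S.Finite) (hgen : Subgroup.closure S = ⊤) (n : ℕ) :
    {g : G | wordLength S g ≤ n}.Finite := by
  refine ((finite_Iic n).biUnion fun m _ => finite_setOf_list_prod hS m).subset ?_
  intro g hg
  -- Generation rules out the default value `sInf ∅ = 0`, which would put unrepresented elements
  -- into every ball.
  have hne : {n : ℕ | ∃ l : List G, (∀ s ∈ l, s ∈ S ∨ s⁻¹ ∈ S) ∧ l.prod = g ∧
      l.length = n}.Nonempty := by
    have hg : g ∈ (Subgroup.closure S).toSubmonoid := hgen ▸ Subgroup.mem_top g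
    rw [Subgroup.closure_toSubmonoid] at hg
    obtain ⟨l, hl, hp⟩ := Submonoid.exists_list_of_mem_closure hg
    exact ⟨l.length, l, fun s hs => hl s hs, hp, rfl⟩
  exact mem_biUnion (x := wordLength S g) hg (Nat.sInf_mem hne)

/-- A map of groups is coarse if it maps pairs at bounded distance to pairs at bounded distance. -/
def IsCoarse (φ : G → H) : Prop :=
  ∀ F : Set G, F.Finite → {h : H | ∃ g g', g⁻¹ * g' ∈ F ∧ h = (φ g)⁻¹ * φ g'}.Finite

/-- Since word balls are finite, bounded distance of `g` and `g'` means that `g⁻¹ * g'` ranges over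
a finite set; this removes the word metrics from the rest of the argument. -/
theorem QuasiIsometricGroups.exists_isCoarse (h : QuasiIsometricGroups G H) :
    ∃ (φ : G → H) (ψ : H → G), IsCoarse φ ∧ IsCoarse ψ ∧
      {k | ∃ g, k = g⁻¹ * ψ (φ g)}.Finite ∧ {k | ∃ h, k = h⁻¹ * φ (ψ h)}.Finite := by
  obtain ⟨S, T, hS, hSg, hT, hTg, φ, K, C, hK, hC, hφ, hsurj⟩ := h
  have hK0 : 0 < K := by linarith
  have hcoarse : IsCoarse φ := by
    intro F hF
    obtain ⟨n, hn⟩ := (hF.image (wordLength S)).bddAbove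
    refine (finite_wordLength_le hT hTg ⌊K * n + C⌋₊).subset ?_
    rintro _ ⟨g, g', hg, rfl⟩
    refine Nat.le_floor (((hφ g g').2).trans ?_)
    have : (wordLength S (g⁻¹ * g') : ℝ) ≤ n := by exact_mod_cast hn ⟨_, hg, rfl⟩
    unfold wordDist
    gcongr
  -- The lower quasi-isometry bound: `φ` also reflects bounded pairs. Coarseness of the
  -- quasi-inverse `ψ` follows by inserting its two error terms.
  have hinv : ∀ F : Set H, F.Finite → {k : G | ∃ g g', (φ g)⁻¹ * φ g' ∈ F ∧
      k = g⁻¹ * g'}.Finite := by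
    intro F hF
    obtain ⟨n, hn⟩ := (hF.image (wordLength T)).bddAbove
    refine (finite_wordLength_le hS hSg ⌊K * (n + C)⌋₊).subset ?_
    rintro _ ⟨g, g', hg, rfl⟩
    refine Nat.le_floor ?_
    have h1 : (wordLength T ((φ g)⁻¹ * φ g') : ℝ) ≤ n := by exact_mod_cast hn ⟨_, hg, rfl⟩
    have h2 := (hφ g g').1
    unfold wordDist at h2
    have h3 : (wordLength S (g⁻¹ * g') : ℝ) / K ≤ n + C := by linarith
    rwa [div_le_iff₀' hK0] at h3
  choose ψ hψ using hsurj
  have hF0 : {k : H | ∃ h, k = (φ (ψ h))⁻¹ * h}.Finite := by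
    refine (finite_wordLength_le hT hTg ⌊C⌋₊).subset ?_
    rintro _ ⟨h, rfl⟩
    exact Nat.le_floor (hψ h)
  set F0 := {k : H | ∃ h, k = (φ (ψ h))⁻¹ * h} with hF0def
  refine ⟨φ, ψ, hcoarse, ?_, ?_, ?_⟩
  · intro F hF
    refine (hinv _ (Finite.image2 (fun a b => a * b) (Finite.image2 (fun a b => a * b) hF0 hF)
      hF0.inv)).subset ?_
    rintro _ ⟨h, h', hh, rfl⟩
    refine ⟨ψ h, ψ h', ⟨_, ⟨_, ⟨h, rfl⟩, _, hh, rfl⟩, h'⁻¹ * φ (ψ h'), ⟨h', by simp⟩, ?_⟩, rfl⟩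
    simp [mul_assoc]
  · refine (hinv _ hF0.inv).subset ?_
    rintro _ ⟨g, rfl⟩
    exact ⟨g, _, ⟨φ g, by simp⟩, rfl⟩
  · refine hF0.inv.subset ?_
    rintro _ ⟨h, rfl⟩
    exact ⟨h, by simp⟩

end Groups

/-! ### Absolute retracts as absolute extensors -/

/-- The empty set is closed in a point, and a point does not retract to it. -/
theorem IsAR.nonempty {X : Type u} [TopologicalSpace X] (hX : IsAR X) : Nonempty X := by
  by_contra h
  rw [not_nonempty_iff] at h
  obtain ⟨r, -, -⟩ := hX.exists_retraction PUnit.{u + 1} (fun x => h.elim x)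
    ⟨⟨⟨Subsingleton.elim _ _⟩, fun x => h.elim x⟩, by simp [range_eq_empty]⟩
  exact h.elim (r PUnit.unit)

theorem exists_isClosedEmbedding_pi_real (X : Type*) [MetricSpace X] [ProperSpace X] [Nonempty X] :
    ∃ e : X → ℕ → ℝ, IsClosedEmbedding e := by
  have hc : Continuous fun (x : X) (n : ℕ) => dist (TopologicalSpace.denseSeq X n) x := by fun_prop
  refine ⟨fun x n => dist (TopologicalSpace.denseSeq X n) x,
    .of_continuous_injective_isClosedMap hc ?_ ?_⟩
  · intro x y hxy
    have : (fun z => dist z x) = fun z => dist z y :=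
      (TopologicalSpace.denseRange_denseSeq X).equalizer (by fun_prop) (by fun_prop) hxy
    exact Eq.symm (by simpa using congrFun this y)
  · exact (isProperMap_of_comp_of_t2 (g := fun v : ℕ → ℝ => v 0) hc (by fun_prop)
      (isProperMap_dist _)).isClosedMap

/-- As a retract of `ℕ → ℝ`, the space inherits extension properties from Tietze's theorem applied
in each coordinate. -/
theorem IsAR.exists_retraction_pi_real {X : Type u} [MetricSpace X] [ProperSpace X]
    (hX : IsAR X) : ∃ (e : X → ℕ → ℝ) (r : (ℕ → ℝ) → X), Continuous e ∧ Continuous r ∧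
      ∀ x, r (e x) = x := by
  have := hX.nonempty
  obtain ⟨e, he⟩ := exists_isClosedEmbedding_pi_real X
  have : TopologicalSpace.MetrizableSpace (ULift.{u} (ℕ → ℝ)) :=
    Homeomorph.ulift.isEmbedding.metrizableSpace
  have : TopologicalSpace.SeparableSpace (ULift.{u} (ℕ → ℝ)) :=
    Homeomorph.ulift.symm.surjective.denseRange.separableSpace Homeomorph.ulift.symm.continuous
  obtain ⟨r, hr, hre⟩ := hX.exists_retraction (ULift.{u} (ℕ → ℝ)) (ULift.up ∘ e)
    (Homeomorph.ulift.symm.isClosedEmbedding.comp he)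
  exact ⟨e, r ∘ ULift.up, he.continuous, hr.comp continuous_uliftUp, hre⟩

theorem IsAR.exists_extension {X : Type u} [MetricSpace X] [ProperSpace X] (hX : IsAR X)
    {W : Type w} [TopologicalSpace W] [NormalSpace W] {A : Set W} (hA : IsClosed A) {f : W → X}
    (hf : ContinuousOn f A) : ∃ F : W → X, Continuous F ∧ EqOn F f A := by
  obtain ⟨e, r, he, hr, hre⟩ := hX.exists_retraction_pi_real
  obtain ⟨F, hF⟩ := ContinuousMap.exists_restrict_eq hA
    (⟨A.domRestrict (e ∘ f), (he.comp_continuousOn hf).domRestrict⟩ : C(A, ℕ → ℝ))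
  refine ⟨r ∘ F, hr.comp F.continuous, fun x hx => ?_⟩
  have : F x = e (f x) := DFunLike.congr_fun hF ⟨x, hx⟩
  simp [this, hre]

/-- The image of `K` in `ℕ → ℝ` lies in a compact box. Truncating Tietze extensions to the box makes
`L`, the retracted box, depend on `K` alone. -/
theorem IsAR.exists_extension_compact {X : Type u} [MetricSpace X] [ProperSpace X] (hX : IsAR X)
    {K : Set X} (hK : IsCompact K) : ∃ L : Set X, IsCompact L ∧
      ∀ (W : Type w) [TopologicalSpace W] [NormalSpace W] (A : Set W) (f : W → X), IsClosed A →
        ContinuousOn f A → MapsTo f A K →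
        ∃ F : W → X, Continuous F ∧ EqOn F f A ∧ ∀ x, F x ∈ L := by
  obtain ⟨e, r, he, hr, hre⟩ := hX.exists_retraction_pi_real
  have hM : ∀ n, ∃ M : ℝ, 0 ≤ M ∧ ∀ x ∈ K, |e x n| ≤ M := by
    intro n
    obtain ⟨M, hM⟩ := hK.exists_bound_of_continuousOn (f := fun x => e x n) (by fun_prop)
    exact ⟨max M 0, le_max_right _ _, fun x hx => (hM x hx).trans (le_max_left _ _)⟩
  choose M hM0 hM using hM
  refine ⟨r '' (univ.pi fun n => Icc (-M n) (M n)),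
    (isCompact_univ_pi fun n => isCompact_Icc).image hr, ?_⟩
  intro W _ _ A f hA hf hfK
  obtain ⟨F, hF⟩ := ContinuousMap.exists_restrict_eq hA
    (⟨A.domRestrict (e ∘ f), (he.comp_continuousOn hf).domRestrict⟩ : C(A, ℕ → ℝ))
  refine ⟨fun x => r fun n => max (-M n) (min (M n) (F x n)), by fun_prop, fun x hx => ?_,
    fun x => ⟨_, fun n _ => ?_, rfl⟩⟩
  · have : F x = e (f x) := DFunLike.congr_fun hF ⟨x, hx⟩
    have h2 : (fun n => max (-M n) (min (M n) (F x n))) = e (f x) := by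
      funext n
      have := abs_le.1 (hM n _ (hfK hx))
      rw [‹F x = _›, min_eq_right this.2, max_eq_right this.1]
    simp only [h2, hre]
  · exact ⟨le_max_left _ _, max_le (by linarith [hM0 n]) (min_le_left _ _)⟩

/-! ### Geometric actions -/

section Action

variable {G : Type v} [Group G] {X : Type u} [MetricSpace X] [MulAction G X]

theorem IsGeometricAction.exists_dist_le (hG : IsGeometricAction G X) (x₀ : X) :
    ∃ r : ℝ, 0 ≤ r ∧ ∀ x, ∃ g : G, dist x (g • x₀) ≤ r := by
  have := hG.isometric
  obtain ⟨K, hK, hcov⟩ := hG.cocompact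
  obtain ⟨r, hr⟩ := hK.isBounded.subset_closedBall x₀
  refine ⟨max r 0, le_max_right _ _, fun x => ?_⟩
  obtain ⟨g, k, hk, rfl⟩ := hcov x
  exact ⟨g, by rw [dist_smul]; exact (hr hk).trans (le_max_left _ _)⟩

theorem IsGeometricAction.finite_dist_le [ProperSpace X] (hG : IsGeometricAction G X) (x₀ x : X)
    (R : ℝ) : {g : G | dist (g • x₀) x ≤ R}.Finite := by
  have := hG.properlyDiscontinuous
  refine (ProperlyDiscontinuousSMul.finite_disjoint_inter_image (Γ := G)
    (isCompact_singleton (x := x₀)) (isCompact_closedBall x R)).subset fun g hg => ?_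
  exact ⟨g • x₀, ⟨x₀, rfl, rfl⟩, hg⟩

theorem IsGeometricAction.dist_smul_smul (hG : IsGeometricAction G X) (x₀ : X) (g g' : G) :
    dist (g • x₀) (g' • x₀) = dist ((g⁻¹ * g') • x₀) x₀ := by
  have := hG.isometric
  rw [mul_smul, ← dist_smul g (g⁻¹ • g' • x₀), smul_inv_smul, dist_comm]

/-- Maps into balls extend, with control on the size of the image that is uniform over all
balls of the same radius. -/
def HasUniformExtension (X : Type u) [MetricSpace X] : Prop :=
  ∀ R : ℝ, ∃ S : ℝ, ∀ (y : X) (W : Type w) [TopologicalSpace W] [NormalSpace W] (A : Set W)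
    (f : W → X), IsClosed A → ContinuousOn f A → (∀ x ∈ A, dist (f x) y ≤ R) →
      ∃ F : W → X, Continuous F ∧ EqOn F f A ∧ ∀ x, dist (F x) y ≤ S

/-- Some group element brings the ball near `x₀`; extend there, inside one fixed compact set, and
translate back. -/
theorem IsGeometricAction.hasUniformExtension [ProperSpace X] (hG : IsGeometricAction G X)
    (hX : IsAR X) : HasUniformExtension.{u, w} X := by
  have := hG.isometric
  intro R
  obtain ⟨x₀⟩ := hX.nonempty
  obtain ⟨r, -, hr⟩ := hG.exists_dist_le x₀
  obtain ⟨L, hL, hext⟩ := hX.exists_extension_compact.{u, w} (isCompact_closedBall x₀ (R + r))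
  obtain ⟨s, hs⟩ := hL.isBounded.subset_closedBall x₀
  refine ⟨s + r, fun y W _ _ A f hA hf hfR => ?_⟩
  obtain ⟨g, hg⟩ := hr y
  have hgc : Continuous fun x : X => g • x := (isometry_smul X g).continuous
  obtain ⟨F, hF, hFf, hFL⟩ := hext W A (fun x => g⁻¹ • f x) hA
    ((isometry_smul X g⁻¹).continuous.comp_continuousOn hf) fun x hx => by
      rw [Metric.mem_closedBall, ← dist_smul g, smul_inv_smul]
      linarith [dist_triangle (f x) y (g • x₀), hfR x hx]
  refine ⟨fun x => g • F x, hgc.comp hF, fun x hx => by simp [hFf hx], fun x => ?_⟩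
  have h1 : dist (g • F x) (g • x₀) ≤ s := by rw [dist_smul]; exact hs (hFL x)
  linarith [dist_triangle (g • F x) (g • x₀) y, dist_comm y (g • x₀)]

end Action

/-! ### Controlled extension of maps -/

/-- Greedy colouring along a well-order: at most `N` colours are forbidden at each stage. -/
theorem exists_coloring {α : Type*} (r : α → α → Prop) (hsymm : ∀ a b, r a b → r b a) (N : ℕ)
    (hr : ∀ a, {b | r b a}.Finite ∧ {b | r b a}.ncard ≤ N) :
    ∃ col : α → ℕ, (∀ a, col a ≤ N) ∧ ∀ a b, r a b → a ≠ b → col a ≠ col b := by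
  have wf : WellFounded (WellOrderingRel : α → α → Prop) := WellOrderingRel.isWellOrder.wf
  let col : α → ℕ := wf.fix fun a ih => sInf {n | ∀ b (h : WellOrderingRel b a), r b a → ih b h ≠ n}
  have hcol : ∀ a, col a = sInf {n | ∀ b, WellOrderingRel b a → r b a → col b ≠ n} :=
    fun a => wf.fix_eq _ a
  have hex : ∀ a, ∃ n ≤ N, ∀ b, WellOrderingRel b a → r b a → col b ≠ n := by
    intro a
    by_contra! h
    have hsub : (↑(Finset.range (N + 1)) : Set ℕ) ⊆ col '' {b | r b a} := by
      intro n hn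
      obtain ⟨b, -, hb, rfl⟩ := h n (by simpa [Nat.lt_succ_iff] using hn)
      exact ⟨b, hb, rfl⟩
    have h1 := ncard_le_ncard hsub ((hr a).1.image _)
    rw [ncard_coe_finset, Finset.card_range] at h1
    have h2 := (ncard_image_le (f := col) (hr a).1).trans (hr a).2
    omega
  have hmem : ∀ a b, WellOrderingRel b a → r b a → col b ≠ col a := by
    intro a
    obtain ⟨n, -, hn⟩ := hex a
    have := Nat.sInf_mem (s := {n | ∀ b, WellOrderingRel b a → r b a → col b ≠ n}) ⟨n, hn⟩
    rwa [← hcol] at this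
  refine ⟨col, fun a => ?_, fun a b hab hne => ?_⟩
  · obtain ⟨n, hnN, hn⟩ := hex a
    rw [hcol]
    exact (Nat.sInf_le (s := {n | ∀ b, WellOrderingRel b a → r b a → col b ≠ n}) hn).trans hnN
  · rcases trichotomous_of WellOrderingRel a b with h | h | h
    · exact hmem b a h hab
    · exact absurd h hne
    · exact (hmem a b h (hsymm a b hab)).symm

/-- Induct on colours. Sets of one colour are disjoint, so the extensions over them do not interact.
Each round worsens the bound by a uniform amount, and there are only `N + 1` rounds. -/
theorem HasUniformExtension.exists_controlled_extension {X : Type u} [MetricSpace X]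
    (hX : HasUniformExtension.{u, w} X) {W : Type w} [TopologicalSpace W] [NormalSpace W]
    {ι : Type*} {P : ι → Set W} (hP : ∀ i, IsClosed (P i)) (hlf : LocallyFinite P)
    (hcov : ∀ x, ∃ i, x ∈ P i) {col : ι → ℕ} {N : ℕ} (hcol : ∀ i, col i ≤ N)
    (hdisj : ∀ i j, i ≠ j → (P i ∩ P j).Nonempty → col i ≠ col j) {c : ι → X} {D : ℝ}
    (hc : ∀ i j, (P i ∩ P j).Nonempty → dist (c i) (c j) ≤ D) {A : Set W} (hA : IsClosed A)
    {f : W → X} (hf : ContinuousOn f A) {R₀ : ℝ} (hfR : ∀ i, ∀ x ∈ A, x ∈ P i →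
      dist (f x) (c i) ≤ R₀) :
    ∃ F : W → X, Continuous F ∧ EqOn F f A ∧ ∃ R, ∀ i, ∀ x ∈ P i, dist (F x) (c i) ≤ R := by
  classical
  let B : ℕ → Set W := fun k => A ∪ ⋃ i : {i // col i < k}, P i
  have hB : ∀ k, IsClosed (B k) := fun k =>
    hA.union ((hlf.comp_injective Subtype.val_injective).isClosed_iUnion fun i => hP i)
  have key : ∀ k, ∃ (F : W → X) (R : ℝ), ContinuousOn F (B k) ∧ EqOn F f A ∧
      ∀ i, ∀ x ∈ B k, x ∈ P i → dist (F x) (c i) ≤ R := by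
    intro k
    induction k with
    | zero =>
      have hB0 : B 0 = A := by ext x; simp [B]
      exact ⟨f, R₀, by rwa [hB0], fun _ _ => rfl, by rwa [hB0]⟩
    | succ k ih =>
      obtain ⟨F, R, hF, hFf, hFR⟩ := ih
      obtain ⟨S, hS⟩ := hX R
      have hext := fun i => hS (c i) W (B k ∩ P i) F ((hB k).inter (hP i))
        (hF.mono inter_subset_left) fun x hx => hFR i x hx.1 hx.2
      choose E hE hEF hES using hext
      let F' : W → X := fun x => if x ∈ B k then F x else
        if h : ∃ i, col i = k ∧ x ∈ P i then E h.choose x else F x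
      have hF'F : ∀ x ∈ B k, F' x = F x := fun x hx => if_pos hx
      have hF'E : ∀ i, col i = k → ∀ x ∈ P i, F' x = E i x := by
        intro i hi x hx
        by_cases hxB : x ∈ B k
        · rw [hF'F x hxB, hEF i ⟨hxB, hx⟩]
        · have h : ∃ i, col i = k ∧ x ∈ P i := ⟨i, hi, hx⟩
          have h2 : h.choose = i := by
            by_contra hne
            exact hdisj _ _ hne ⟨x, h.choose_spec.2, hx⟩ (h.choose_spec.1.trans hi.symm)
          simp only [F', if_neg hxB, dif_pos h, h2]
      have hBs : B (k + 1) = B k ∪ ⋃ i : {i // col i = k}, P i := by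
        ext x
        simp only [B, mem_union, mem_iUnion, Subtype.exists, exists_prop, Nat.lt_succ_iff_lt_or_eq,
          or_and_right, exists_or, or_assoc]
      have hlf' : LocallyFinite fun i : {i // col i = k} => P i :=
        hlf.comp_injective Subtype.val_injective
      -- A point newly treated in `P j` may also lie in `P i`; `D` pays for the change of centre.
      refine ⟨F', max R (S + D), ?_, fun x hx => ?_, ?_⟩
      · rw [hBs]
        refine ContinuousOn.union_of_isClosed (hF.congr hF'F) ?_ (hB k)
          (hlf'.isClosed_iUnion fun i => hP i)
        exact hlf'.continuousOn_iUnion (fun i => hP i) fun i =>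
          (hE i).continuousOn.congr (hF'E i i.2)
      · rw [hF'F x (Or.inl hx), hFf hx]
      · intro i x hx hxi
        rw [hBs] at hx
        rcases hx with hx | hx
        · rw [hF'F x hx]
          exact (hFR i x hx hxi).trans (le_max_left _ _)
        · obtain ⟨j, hj⟩ := mem_iUnion.1 hx
          rw [hF'E j j.2 x hj]
          refine le_trans ?_ (le_max_right _ _)
          linarith [dist_triangle (E j x) (c j) (c i), hES j x, hc j i ⟨x, hj, hxi⟩]
  obtain ⟨F, R, hF, hFf, hFR⟩ := key (N + 1)
  have hBu : ∀ i, ∀ x ∈ P i, x ∈ B (N + 1) := fun i x hx =>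
    Or.inr (mem_iUnion.2 ⟨⟨i, Nat.lt_succ_of_le (hcol i)⟩, hx⟩)
  refine ⟨F, ?_, hFf, R, fun i x hx => hFR i x (hBu i x hx) hx⟩
  rw [← continuousOn_univ]
  refine hF.mono fun x _ => ?_
  obtain ⟨i, hi⟩ := hcov x
  exact hBu i x hi

/-! ### Continuous coarse equivalences -/

/-- A map of metric spaces is bornologous if it maps pairs at bounded distance to pairs at bounded
distance. -/
def IsBornologous {X : Type*} {Y : Type*} [MetricSpace X] [MetricSpace Y] (f : X → Y) : Prop :=
  ∀ s : ℝ, ∃ s' : ℝ, ∀ x x', dist x x' ≤ s → dist (f x) (f x') ≤ s'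

section

variable {G H : Type*} [Group G] [Group H] {X : Type u} {Y : Type v} [MetricSpace X]
  [MetricSpace Y] [MulAction G X] [MulAction H Y]

theorem Set.Finite.exists_dist_smul_le {F : Set G} (hF : F.Finite) (x₀ : X) :
    ∃ s : ℝ, ∀ k ∈ F, dist (k • x₀) x₀ ≤ s := by
  obtain ⟨s, hs⟩ := (hF.image fun k => dist (k • x₀) x₀).bddAbove
  exact ⟨s, fun k hk => hs ⟨k, hk, rfl⟩⟩

theorem IsCoarse.exists_dist_le [ProperSpace X] {φ : G → H} (hφ : IsCoarse φ)
    (hG : IsGeometricAction G X) (hH : IsGeometricAction H Y) (x₀ : X) (y₀ : Y) (s : ℝ) :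
    ∃ s' : ℝ, ∀ g g' : G, dist (g • x₀) (g' • x₀) ≤ s →
      dist (φ g • y₀) (φ g' • y₀) ≤ s' := by
  obtain ⟨s', hs'⟩ := (hφ _ (hG.finite_dist_le x₀ x₀ s)).exists_dist_smul_le y₀
  refine ⟨s', fun g g' hg => ?_⟩
  rw [hH.dist_smul_smul]
  rw [hG.dist_smul_smul] at hg
  exact hs' _ ⟨g, g', hg, rfl⟩

/-- The pieces are preimages under `q` of `r`-balls about the orbit. Meeting balls have centres
within `2 * r`, which bounds the number of neighbours. The map `q` allows both `X` and `X ×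
unitInterval` as domain. -/
theorem IsGeometricAction.exists_controlled_extension [ProperSpace X]
    (hG : IsGeometricAction G X) {x₀ : X} {r : ℝ} (hr : ∀ x, ∃ g : G, dist x (g • x₀) ≤ r)
    (hY : HasUniformExtension.{v, w} Y) {W : Type w} [TopologicalSpace W] [NormalSpace W]
    {q : W → X} (hq : Continuous q) {c : G → Y}
    (hc : ∀ s : ℝ, ∃ s' : ℝ, ∀ g g' : G, dist (g • x₀) (g' • x₀) ≤ s → dist (c g) (c g') ≤ s')
    {A : Set W} (hA : IsClosed A) {f : W → Y} (hf : ContinuousOn f A) {R₀ : ℝ}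
    (hfR : ∀ g : G, ∀ x ∈ A, dist (q x) (g • x₀) ≤ r → dist (f x) (c g) ≤ R₀) :
    ∃ F : W → Y, Continuous F ∧ EqOn F f A ∧
      ∃ R, ∀ (g : G) (x), dist (q x) (g • x₀) ≤ r → dist (F x) (c g) ≤ R := by
  have hnear : ∀ g g' : G, ((q ⁻¹' Metric.closedBall (g • x₀) r) ∩
      (q ⁻¹' Metric.closedBall (g' • x₀) r)).Nonempty →
      dist (g • x₀) (g' • x₀) ≤ 2 * r := by
    rintro g g' ⟨x, hx, hx'⟩
    have h1 : dist (q x) (g • x₀) ≤ r := hx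
    have h2 : dist (q x) (g' • x₀) ≤ r := hx'
    linarith [dist_triangle_left (g • x₀) (g' • x₀) (q x)]
  have hE := hG.finite_dist_le x₀ x₀ (2 * r)
  obtain ⟨col, hcol, hdisj⟩ := exists_coloring
    (fun g g' : G => dist (g • x₀) (g' • x₀) ≤ 2 * r) (fun a b h => by rwa [dist_comm])
    {g : G | dist (g • x₀) x₀ ≤ 2 * r}.ncard (fun a => by
      have hsub : {b : G | dist (b • x₀) (a • x₀) ≤ 2 * r} ⊆
          (fun k => a * k) '' {g : G | dist (g • x₀) x₀ ≤ 2 * r} := fun b hb =>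
        ⟨a⁻¹ * b, by rwa [mem_ofPred_eq, ← hG.dist_smul_smul, dist_comm], by simp⟩
      exact ⟨(hE.image _).subset hsub,
        (ncard_le_ncard hsub (hE.image _)).trans (ncard_image_le hE)⟩)
  obtain ⟨D, hD⟩ := hc (2 * r)
  have hlf : LocallyFinite fun g : G => Metric.closedBall (g • x₀) r := by
    intro x
    refine ⟨Metric.ball x 1, Metric.ball_mem_nhds x one_pos,
      (hG.finite_dist_le x₀ x (r + 1)).subset ?_⟩
    rintro g ⟨y, hy, hy'⟩
    have h1 : dist y (g • x₀) ≤ r := hy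
    have h2 : dist y x < 1 := hy'
    exact (dist_triangle_left (g • x₀) x y).trans (by linarith)
  exact hY.exists_controlled_extension (P := fun g => q ⁻¹' Metric.closedBall (g • x₀) r)
    (fun g => Metric.isClosed_closedBall.preimage hq) (hlf.preimage_continuous hq)
    (fun x => hr (q x)) hcol (fun g g' hne h => hdisj g g' (hnear g g' h) hne)
    (fun g g' h => hD g g' (hnear g g' h)) hA hf hfR

theorem isBornologous_of_dist_le {f : X → Y} {x₀ : X} {r R : ℝ} {c : G → Y}
    (hr : ∀ x, ∃ g : G, dist x (g • x₀) ≤ r)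
    (hc : ∀ s : ℝ, ∃ s' : ℝ, ∀ g g' : G, dist (g • x₀) (g' • x₀) ≤ s → dist (c g) (c g') ≤ s')
    (hf : ∀ (g : G) (x), dist x (g • x₀) ≤ r → dist (f x) (c g) ≤ R) : IsBornologous f := by
  intro s
  obtain ⟨s', hs'⟩ := hc (r + s + r)
  refine ⟨R + s' + R, fun x x' hxx => ?_⟩
  obtain ⟨g, hg⟩ := hr x
  obtain ⟨g', hg'⟩ := hr x'
  have h1 := hs' g g' (by
    linarith [dist_triangle4 (g • x₀) x x' (g' • x₀), dist_comm x (g • x₀)])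
  linarith [dist_triangle4 (f x) (c g) (c g') (f x'), hf g x hg, hf g' x' hg',
    dist_comm (f x') (c g')]

theorem exists_dist_comp_le {f : X → Y} {f' : Y → X} {x₀ : X} {y₀ : Y} {r r' R R' k : ℝ}
    {φ : G → H} {ψ : H → G} (hr' : ∀ y, ∃ h : H, dist y (h • y₀) ≤ r')
    (hf : ∀ (g : G) (x), dist x (g • x₀) ≤ r → dist (f x) (φ g • y₀) ≤ R)
    (hf' : ∀ (h : H) (y), dist y (h • y₀) ≤ r' → dist (f' y) (ψ h • x₀) ≤ R')
    (hψ : ∀ s : ℝ, ∃ s' : ℝ, ∀ h h' : H, dist (h • y₀) (h' • y₀) ≤ s →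
      dist (ψ h • x₀) (ψ h' • x₀) ≤ s')
    (hk : ∀ g : G, dist (ψ (φ g) • x₀) (g • x₀) ≤ k) :
    ∃ c, ∀ (g : G) (x), dist x (g • x₀) ≤ r → dist (f' (f x)) (g • x₀) ≤ c := by
  obtain ⟨s', hs'⟩ := hψ (r' + R)
  refine ⟨R' + s' + k, fun g x hx => ?_⟩
  obtain ⟨h, hh⟩ := hr' (f x)
  have h1 := hs' h (φ g) (by
    linarith [dist_triangle_left (h • y₀) (φ g • y₀) (f x), hf g x hx])
  linarith [dist_triangle4 (f' (f x)) (ψ h • x₀) (ψ (φ g) • x₀) (g • x₀), hf' h _ hh, hk g]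

theorem QuasiIsometricGroups.exists_continuous_equivalence [ProperSpace X] [ProperSpace Y]
    (hGH : QuasiIsometricGroups G H) (hX : IsAR X) (hY : IsAR Y)
    (hG : IsGeometricAction G X) (hH : IsGeometricAction H Y) :
    ∃ (f : X → Y) (f' : Y → X) (h : X × unitInterval → X) (c : ℝ), Continuous f ∧ Continuous f' ∧
      Continuous h ∧ IsBornologous f ∧ IsBornologous f' ∧ (∀ x, dist (f' (f x)) x ≤ c) ∧
      (∀ y, dist (f (f' y)) y ≤ c) ∧ (∀ x, h (x, 0) = x) ∧ (∀ x, h (x, 1) = f' (f x)) ∧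
      ∀ x t, dist (h (x, t)) x ≤ c := by
  obtain ⟨φ, ψ, hφ, hψ, hψφ, hφψ⟩ := hGH.exists_isCoarse
  obtain ⟨x₀⟩ := hX.nonempty
  obtain ⟨y₀⟩ := hY.nonempty
  obtain ⟨r, -, hr⟩ := hG.exists_dist_le x₀
  obtain ⟨r', -, hr'⟩ := hH.exists_dist_le y₀
  have hφd := hφ.exists_dist_le hG hH x₀ y₀
  have hψd := hψ.exists_dist_le hH hG y₀ x₀
  have hk : ∃ k, ∀ g : G, dist (ψ (φ g) • x₀) (g • x₀) ≤ k := by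
    obtain ⟨k, hk⟩ := hψφ.exists_dist_smul_le x₀
    refine ⟨k, fun g => ?_⟩
    rw [dist_comm, hG.dist_smul_smul]
    exact hk _ ⟨g, rfl⟩
  have hk' : ∃ k, ∀ h : H, dist (φ (ψ h) • y₀) (h • y₀) ≤ k := by
    obtain ⟨k, hk⟩ := hφψ.exists_dist_smul_le y₀
    refine ⟨k, fun g => ?_⟩
    rw [dist_comm, hH.dist_smul_smul]
    exact hk _ ⟨g, rfl⟩
  obtain ⟨k, hk⟩ := hk
  obtain ⟨k', hk'⟩ := hk'
  obtain ⟨f, hf, -, R, hfR⟩ := hG.exists_controlled_extension hr (hH.hasUniformExtension hY)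
    (W := X) continuous_id (c := fun g => φ g • y₀) hφd isClosed_empty (f := fun _ => y₀)
    (continuousOn_empty _) (R₀ := 0) (by simp)
  obtain ⟨f', hf', -, R', hfR'⟩ := hH.exists_controlled_extension hr' (hG.hasUniformExtension hX)
    (W := Y) continuous_id (c := fun h => ψ h • x₀) hψd isClosed_empty (f := fun _ => x₀)
    (continuousOn_empty _) (R₀ := 0) (by simp)
  obtain ⟨c, hc⟩ := exists_dist_comp_le hr' hfR hfR' hψd hk
  obtain ⟨c', hc'⟩ := exists_dist_comp_le hr hfR' hfR hφd hk'
  have hA : IsClosed {p : X × unitInterval | p.2 = 0 ∨ p.2 = 1} :=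
    (isClosed_eq continuous_snd continuous_const).union
      (isClosed_eq continuous_snd continuous_const)
  -- The homotopy is an extension problem: both ends are prescribed and stay close to the orbit
  -- points `g • x₀`.
  obtain ⟨h, hh, hhA, R'', hhR⟩ := hG.exists_controlled_extension hr (hG.hasUniformExtension hX)
    (W := X × unitInterval) continuous_fst (c := fun g => g • x₀) (fun s => ⟨s, fun _ _ h => h⟩)
    hA (f := fun p => if p.2 = 0 then p.1 else f' (f p.1)) (R₀ := max r c) (by
      refine ContinuousOn.union_of_isClosed (s := {p : X × unitInterval | p.2 = 0})
        (t := {p | p.2 = 1}) ?_ ?_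
        (isClosed_eq continuous_snd continuous_const) (isClosed_eq continuous_snd continuous_const)
      · exact continuous_fst.continuousOn.congr fun p hp => if_pos hp
      · refine ((hf'.comp hf).comp continuous_fst).continuousOn.congr fun p hp => if_neg ?_
        rw [show p.2 = 1 from hp]
        exact one_ne_zero) (by
      intro g p _ hp
      split_ifs
      · exact hp.trans (le_max_left _ _)
      · exact (hc g _ hp).trans (le_max_right _ _))
  refine ⟨f, f', h, max (max (c + r) (c' + r')) (R'' + r), hf, hf', hh,
    isBornologous_of_dist_le hr hφd hfR, isBornologous_of_dist_le hr' hψd hfR', ?_, ?_, ?_, ?_, ?_⟩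
  · intro x
    obtain ⟨g, hg⟩ := hr x
    refine le_trans ?_ ((le_max_left _ _).trans (le_max_left _ _))
    linarith [dist_triangle_right (f' (f x)) x (g • x₀), hc g x hg]
  · intro y
    obtain ⟨g, hg⟩ := hr' y
    refine le_trans ?_ ((le_max_right _ _).trans (le_max_left _ _))
    linarith [dist_triangle_right (f (f' y)) y (g • y₀), hc' g y hg]
  · intro x
    rw [hhA (x := (x, 0)) (Or.inl rfl)]
    simp
  · intro x
    rw [hhA (x := (x, 1)) (Or.inr rfl)]
    simp
  · intro x t
    obtain ⟨g, hg⟩ := hr x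
    refine le_trans ?_ (le_max_right _ _)
    linarith [dist_triangle_right (h (x, t)) x (g • x₀), hhR g (x, t) hg]

end

/-! ### Spaces deforming into an absolute retract are absolute retracts -/

/-- `Ψ` and `K` agree on the compact set `range e × [a, b]`, so the tube lemma gives closeness on a
uniform neighbourhood. -/
theorem exists_pos_forall_near {T W : Type*} [MetricSpace T] [MetricSpace W]
    [CompactSpace T] [Nonempty T] {e : T → W} (he : Continuous e) {Ψ : W × Ioi (0 : ℝ) → T}
    {K : T × Ioi (0 : ℝ) → T} (hΨ : Continuous Ψ) (hK : Continuous K)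
    (hΨK : ∀ t s, Ψ (e t, s) = K (t, s)) {η a : ℝ} (b : ℝ) (hη : 0 < η) (ha : 0 < a) :
    ∃ ε > 0, ∀ w, Metric.infDist w (range e) < ε → ∀ s : Ioi (0 : ℝ), a ≤ s → s ≤ b →
      ∃ t, dist (e t) w < η ∧ dist (Ψ (w, s)) (K (t, s)) < η := by
  have hA : IsCompact (range e) := isCompact_range he
  have hI : IsCompact {s : Ioi (0 : ℝ) | a ≤ s ∧ s ≤ b} := by
    rw [Subtype.isCompact_iff]
    convert isCompact_Icc (a := a) (b := b) using 1
    ext s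
    simp only [mem_image, Subtype.exists, mem_Icc]
    exact ⟨fun ⟨_, _, h, rfl⟩ => h, fun h => ⟨s, ha.trans_le h.1, h, rfl⟩⟩
  have hO : IsOpen {q : W × Ioi (0 : ℝ) | ∃ t, dist (e t) q.1 < η ∧ dist (Ψ q) (K (t, q.2)) < η} := by
    have : {q : W × Ioi (0 : ℝ) | ∃ t, dist (e t) q.1 < η ∧ dist (Ψ q) (K (t, q.2)) < η} =
        ⋃ t, {q | dist (e t) q.1 < η} ∩ {q | dist (Ψ q) (K (t, q.2)) < η} := by
      ext q
      simp
    rw [this]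
    refine isOpen_iUnion fun t => IsOpen.inter ?_ ?_ <;>
      exact isOpen_lt (by fun_prop) (by fun_prop)
  obtain ⟨U, V, hU, -, hAU, hIV, hUV⟩ := generalized_tube_lemma hA hI hO (by
    rintro ⟨_, s⟩ ⟨⟨t, rfl⟩, -⟩
    exact ⟨t, by simpa using hη, by simpa [hΨK] using hη⟩)
  obtain ⟨ε, hε, hεU⟩ := hA.exists_thickening_subset_open hU hAU
  refine ⟨ε, hε, fun w hw s has hsb => ?_⟩
  have hwU : w ∈ U := hεU ((Metric.mem_thickening_iff_infDist_lt (range_nonempty e)).2 hw)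
  exact hUV (show (w, s) ∈ U ×ˢ V from ⟨hwU, hIV ⟨has, hsb⟩⟩)

/-- The series turns a sequence of thresholds into a continuous function that vanishes with `d`, yet
slowly: it is still at least `(1 / 2) ^ m` when `d` is at least `ε m`. -/
theorem continuous_tsum_geometric_min {W : Type*} [TopologicalSpace W] {d : W → ℝ}
    (hd : Continuous d) (hd0 : ∀ w, 0 ≤ d w) {ε : ℕ → ℝ} (hε : ∀ n, 0 < ε n) :
    Continuous (fun w => ∑' n : ℕ, (1 / 2 : ℝ) ^ n * min 1 (d w / ε n)) ∧
      (∀ w, d w = 0 → ∑' n : ℕ, (1 / 2 : ℝ) ^ n * min 1 (d w / ε n) = 0) ∧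
      (∀ w, ∑' n : ℕ, (1 / 2 : ℝ) ^ n * min 1 (d w / ε n) ≤ 2) ∧
      (∀ w m, ε m ≤ d w → (1 / 2 : ℝ) ^ m ≤ ∑' n : ℕ, (1 / 2 : ℝ) ^ n * min 1 (d w / ε n)) := by
  have hnn : ∀ w n, 0 ≤ (1 / 2 : ℝ) ^ n * min 1 (d w / ε n) := fun w n =>
    mul_nonneg (by positivity) (le_min zero_le_one (div_nonneg (hd0 w) (hε n).le))
  have hle : ∀ w n, (1 / 2 : ℝ) ^ n * min 1 (d w / ε n) ≤ (1 / 2) ^ n := fun w n =>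
    mul_le_of_le_one_right (by positivity) (min_le_left _ _)
  have hsum : ∀ w, Summable fun n => (1 / 2 : ℝ) ^ n * min 1 (d w / ε n) := fun w =>
    Summable.of_nonneg_of_le (hnn w) (hle w) summable_geometric_two
  refine ⟨?_, ?_, fun w => ?_, fun w m hm => ?_⟩
  · refine continuous_tsum (fun n => by fun_prop) summable_geometric_two fun n w => ?_
    rw [Real.norm_of_nonneg (hnn w n)]
    exact hle w n
  · intro w hw
    simp [hw]
  · exact ((hsum w).tsum_le_tsum (hle w) summable_geometric_two).trans_eq tsum_geometric_two
  · have h1 : (1 / 2 : ℝ) ^ m * min 1 (d w / ε m) = (1 / 2) ^ m := by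
      rw [min_eq_left ((one_le_div (hε m)).2 hm), mul_one]
    exact h1 ▸ (hsum w).le_tsum m fun n _ => hnn w n

/-- Off `T` the retraction is `Ψ (w, l w)`. Near `T` the time `l w` is small, so `K` hardly moves
points, but large enough relative to the distance to `T` that `Ψ` is close to `K`. -/
theorem exists_retraction_of_homotopy {T W : Type*} [MetricSpace T] [MetricSpace W]
    [CompactSpace T] [Nonempty T] {e : T → W} (he : Isometry e) {Ψ : W × Ioi (0 : ℝ) → T}
    {K : T × ℝ → T} (hΨ : Continuous Ψ) (hK : Continuous K) (hK0 : ∀ t, K (t, 0) = t)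
    (hΨK : ∀ t (s : Ioi (0 : ℝ)), Ψ (e t, s) = K (t, s)) :
    ∃ r : W → T, Continuous r ∧ ∀ t, r (e t) = t := by
  classical
  have hA : IsClosed (range e) := (isCompact_range he.continuous).isClosed
  have hAne : (range e).Nonempty := range_nonempty e
  -- The upper end `2` of the time interval is the bound for the series `l`.
  have hex := fun n : ℕ => exists_pos_forall_near he.continuous hΨ
    (K := fun q => K (q.1, q.2)) (by fun_prop) hΨK 2
    (show (0 : ℝ) < (1 / 2) ^ n by positivity) (show (0 : ℝ) < (1 / 2) ^ (n + 1) by positivity)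
  choose ε' hε' hnear' using hex
  obtain ⟨ε, hε, hεt, hnear⟩ : ∃ ε : ℕ → ℝ, (∀ n, 0 < ε n) ∧ (∀ n, ε n ≤ (1 / 2) ^ n) ∧
      ∀ n w, Metric.infDist w (range e) < ε n → ∀ s : Ioi (0 : ℝ), (1 / 2) ^ (n + 1) ≤ (s : ℝ) →
        (s : ℝ) ≤ 2 → ∃ t, dist (e t) w < (1 / 2) ^ n ∧
          dist (Ψ (w, s)) (K (t, s)) < (1 / 2) ^ n :=
    ⟨fun n => min (ε' n) ((1 / 2) ^ n), fun n => lt_min (hε' n) (by positivity),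
      fun n => min_le_right _ _, fun n w hw => hnear' n w (hw.trans_le (min_le_left _ _))⟩
  obtain ⟨hlc, hl0, hl2, hlm⟩ := continuous_tsum_geometric_min
    (Metric.continuous_infDist_pt (range e)) (fun w => Metric.infDist_nonneg) hε
  set l : W → ℝ := fun w => ∑' n : ℕ, (1 / 2 : ℝ) ^ n * min 1 (Metric.infDist w (range e) / ε n)

  have hpos : ∀ w, w ∉ range e → 0 < Metric.infDist w (range e) := fun w hw =>
    (hA.notMem_iff_infDist_pos hAne).1 hw
  have hexm : ∀ w, w ∉ range e → ∃ m, ε m ≤ Metric.infDist w (range e) := by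
    intro w hw
    obtain ⟨m, hm⟩ := exists_pow_lt_of_lt_one (hpos w hw) (show (1 / 2 : ℝ) < 1 by norm_num)
    exact ⟨m, (hεt m).trans hm.le⟩
  have hlpos : ∀ w, w ∉ range e → 0 < l w := by
    intro w hw
    obtain ⟨m, hm⟩ := hexm w hw
    exact lt_of_lt_of_le (by positivity) (hlm w m hm)
  let r : W → T := fun w => if hw : w ∈ range e then hw.choose else Ψ (w, ⟨l w, hlpos w hw⟩)
  have hre : ∀ t, r (e t) = t := fun t => by
    have h : e t ∈ range e := ⟨t, rfl⟩
    simp only [r, dif_pos h]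
    exact he.injective h.choose_spec
  refine ⟨r, ?_, hre⟩
  rw [continuous_iff_continuousAt]
  intro w
  by_cases hw : w ∈ range e
  · obtain ⟨t₀, rfl⟩ := hw
    rw [ContinuousAt, hre, Metric.tendsto_nhds]
    intro η hη
    obtain ⟨ρ, hρ, hKρ⟩ := Metric.continuousAt_iff.1 (hK.continuousAt (x := (t₀, 0))) (η / 2)
      (half_pos hη)
    obtain ⟨N, hN⟩ := exists_pow_lt_of_lt_one (lt_min (half_pos hρ) (half_pos hη))
      (show (1 / 2 : ℝ) < 1 by norm_num)
    have hd0 : Metric.infDist (e t₀) (range e) = 0 := Metric.infDist_zero_of_mem ⟨t₀, rfl⟩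
    have h1 : ∀ᶠ w in 𝓝 (e t₀), dist w (e t₀) < min (ρ / 2) η :=
      Metric.ball_mem_nhds _ (lt_min (half_pos hρ) hη)
    have h2 : ∀ᶠ w in 𝓝 (e t₀), l w < ρ :=
      hlc.continuousAt.eventually_lt_const ((hl0 _ hd0).trans_lt hρ)
    have h3 : ∀ᶠ w in 𝓝 (e t₀), ∀ n ∈ Finset.range (N + 1),
        Metric.infDist w (range e) < ε n := by
      rw [Filter.eventually_all_finset]
      intro n _
      exact (Metric.continuous_infDist_pt (range e)).continuousAt.eventually_lt_const
        (hd0.trans_lt (hε n))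
    filter_upwards [h1, h2, h3] with w h1 h2 h3
    by_cases hw : w ∈ range e
    · obtain ⟨t, rfl⟩ := hw
      rw [hre, ← he.dist_eq]
      exact h1.trans_le (min_le_right _ _)
    · have hm := Nat.find_spec (hexm w hw)
      have hmin : ∀ n < Nat.find (hexm w hw), Metric.infDist w (range e) < ε n := fun n hn =>
        not_le.1 (Nat.find_min (hexm w hw) hn)
      have hNm : N < Nat.find (hexm w hw) := by
        by_contra! hle
        exact absurd hm (not_le.2 (h3 _ (Finset.mem_range.2 (Nat.lt_succ_of_le hle))))
      -- The first threshold reached is `ε (m + 1)`. Hence the distance is below `ε m` while `l w ≥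
      -- (1 / 2) ^ (m + 1)`, exactly the range of times covered at level `m`.
      obtain ⟨m, hmeq⟩ : ∃ m, Nat.find (hexm w hw) = m + 1 :=
        ⟨Nat.find (hexm w hw) - 1, by omega⟩
      rw [hmeq] at hm hmin hNm
      obtain ⟨t, ht1, ht2⟩ := hnear m w (hmin m (Nat.lt_succ_self m)) ⟨l w, hlpos w hw⟩
        (hlm w (m + 1) hm) (hl2 w)
      have hmN : (1 / 2 : ℝ) ^ m < min (ρ / 2) (η / 2) :=
        (pow_le_pow_of_le_one (by norm_num) (by norm_num) (Nat.lt_succ_iff.1 hNm)).trans_lt hN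
      have hm1 := hmN.trans_le (min_le_left _ _)
      have hm2 := hmN.trans_le (min_le_right _ _)
      have ht0 : dist t t₀ < ρ := by
        rw [← he.dist_eq]
        linarith [dist_triangle (e t) w (e t₀), h1.trans_le (min_le_left _ _)]
      have hKt : dist (K (t, l w)) t₀ < η / 2 := by
        have := @hKρ (t, l w) (by
          rw [Prod.dist_eq]
          refine max_lt ht0 ?_
          rw [Real.dist_0_eq_abs, abs_of_pos (hlpos w hw)]
          exact h2)
        rwa [hK0] at this
      simp only [r, dif_neg hw]
      have ht2' : dist (Ψ (w, ⟨l w, hlpos w hw⟩)) (K (t, l w)) < (1 / 2) ^ m := ht2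
      linarith [dist_triangle (Ψ (w, ⟨l w, hlpos w hw⟩)) (K (t, l w)) t₀]
  · have hc : ContinuousOn r (range e)ᶜ := by
      rw [continuousOn_iff_continuous_domRestrict]
      have : (range e)ᶜ.domRestrict r =
          fun w : ((range e)ᶜ : Set W) => Ψ (w, ⟨l w, hlpos w w.2⟩) := by
        funext w
        exact dif_neg w.2
      rw [this]
      exact hΨ.comp (continuous_subtype_val.prodMk
        ((hlc.comp continuous_subtype_val).subtype_mk _))
    exact hc.continuousAt (hA.isOpen_compl.mem_nhds hw)

/-- At positive times `K` takes values in `X`, so its restriction to the closed subset `T × (0, ∞)`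
of `W × (0, ∞)` extends by the AR property of `X`. -/
theorem IsAR.of_homotopy {X : Type u} [MetricSpace X] [ProperSpace X] (hX : IsAR X)
    {T : Type w} [TopologicalSpace T] [CompactSpace T] [TopologicalSpace.MetrizableSpace T]
    {j : X → T} (hj : IsEmbedding j) {K : T × unitInterval → T} (hK : Continuous K)
    (hK0 : ∀ t, K (t, 0) = t) (hKj : ∀ t s, 0 < s → K (t, s) ∈ range j) : IsAR T := by
  have : Nonempty T := hX.nonempty.map j
  have hsep : TopologicalSpace.SeparableSpace T := by
    let := TopologicalSpace.metrizableSpaceMetric T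
    infer_instance
  refine ⟨inferInstance, hsep, inferInstance, ?_⟩
  intro W _ _ _ e he
  let : MetricSpace W := TopologicalSpace.metrizableSpaceMetric W
  let : MetricSpace T := he.isEmbedding.comapMetricSpace e
  have hiso : Isometry e := Isometry.of_dist_eq fun _ _ => rfl
  let K' : T × ℝ → T := fun q => K (q.1, projIcc 0 1 zero_le_one q.2)
  have hK' : Continuous K' := hK.comp
    (continuous_fst.prodMk (continuous_projIcc.comp continuous_snd))
  have hKj' : ∀ t (s : Ioi (0 : ℝ)), ∃ x, j x = K' (t, s) := by
    intro t s
    refine hKj t _ ?_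
    rw [← Subtype.coe_lt_coe, coe_projIcc]
    exact lt_max_of_lt_right (lt_min zero_lt_one s.2)
  choose k hk using hKj'
  have hc : ContinuousOn (fun q : W × Ioi (0 : ℝ) => k (Function.invFun e q.1) q.2)
      (Prod.fst ⁻¹' range e) := by
    rw [hj.isInducing.continuousOn_iff]
    have hinv : ContinuousOn (Function.invFun e) (range e) := by
      rw [he.isInducing.continuousOn_iff]
      refine continuousOn_id.congr ?_
      rintro _ ⟨t, rfl⟩
      simp [Function.leftInverse_invFun he.injective t]
    have : ContinuousOn (fun q : W × Ioi (0 : ℝ) => K' (Function.invFun e q.1, q.2))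
        (Prod.fst ⁻¹' range e) :=
      hK'.comp_continuousOn ((hinv.comp continuousOn_fst fun _ h => h).prodMk
        (by fun_prop))
    exact this.congr fun q _ => hk _ _
  obtain ⟨Φ, hΦ, hΦk⟩ := hX.exists_extension (he.isClosed_range.preimage continuous_fst) hc
  refine exists_retraction_of_homotopy hiso (hj.continuous.comp hΦ) hK'
    (fun t => by simp [K', hK0]) fun t s => ?_
  rw [Function.comp_apply, hΦk (x := (e t, s)) ⟨t, rfl⟩, hk,
    Function.leftInverse_invFun he.injective t]

/-! ### Transporting a boundary along a proper map -/

/-- Bounded coordinates are multiplied by a weight `ω` that decays at infinity. Keeping `ω` as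
coordinate zero lets one divide it out again, so nothing is lost. -/
theorem exists_isEmbedding_tendsto_zero (X : Type*) [MetricSpace X] [ProperSpace X] [Nonempty X] :
    ∃ e : X → ℕ → ℝ, IsEmbedding e ∧ (∀ x, e x ≠ 0) ∧
      Filter.Tendsto e (Filter.cocompact X) (𝓝 0) := by
  obtain ⟨e₀, he₀⟩ := exists_isClosedEmbedding_pi_real X
  obtain ⟨x₀⟩ := ‹Nonempty X›
  have hpos : ∀ x, 0 < 1 + dist x₀ x := fun x => by positivity
  let ω : X → ℝ := fun x => (1 + dist x₀ x)⁻¹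
  have hω : Continuous ω := Continuous.inv₀ (by fun_prop) fun x => (hpos x).ne'
  have hωpos : ∀ x, 0 < ω x := fun x => inv_pos.2 (hpos x)
  have hω0 : Filter.Tendsto ω (Filter.cocompact X) (𝓝 0) :=
    tendsto_inv_atTop_zero.comp
      (Filter.tendsto_atTop_add_const_left _ _ (tendsto_dist_left_cocompact_atTop x₀))
  let e : X → ℕ → ℝ := fun x n => Nat.casesOn n (ω x) fun k => ω x * Real.arctan (e₀ x k)
  have hec : Continuous e := by
    refine continuous_pi fun n => ?_
    cases n with
    | zero => exact hω
    | succ k =>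
      exact hω.mul (Real.continuous_arctan.comp ((continuous_apply k).comp he₀.continuous))
  let Φ : (ℕ → ℝ) → ℕ → ℝ := fun v n => Real.tan (v (n + 1) / v 0)
  have hΦe : ∀ x, Φ (e x) = e₀ x := by
    intro x
    funext n
    change Real.tan (ω x * Real.arctan (e₀ x n) / ω x) = e₀ x n
    rw [mul_div_cancel_left₀ _ (hωpos x).ne', Real.tan_arctan]
  have hΦc : ∀ x, ContinuousAt Φ (e x) := by
    intro x
    refine continuousAt_pi.2 fun n => ?_
    have h1 : e x (n + 1) / e x 0 = Real.arctan (e₀ x n) :=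
      mul_div_cancel_left₀ _ (hωpos x).ne'
    have h2 : ContinuousAt Real.tan (e x (n + 1) / e x 0) := by
      rw [h1, Real.continuousAt_tan]
      exact (Real.cos_arctan_pos _).ne'
    exact ContinuousAt.comp (f := fun v : ℕ → ℝ => v (n + 1) / v 0) h2
      ((continuous_apply (n + 1)).continuousAt.div (continuous_apply 0).continuousAt
        (hωpos x).ne')
  refine ⟨e, ⟨isInducing_iff_nhds.2 fun x => le_antisymm
    (Filter.tendsto_iff_comap.1 hec.continuousAt) ?_, fun x y hxy => ?_⟩, fun x hx => ?_, ?_⟩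
  · rw [he₀.isInducing.nhds_eq_comap x, ← Filter.tendsto_iff_comap, ← hΦe x]
    have : e₀ = Φ ∘ e := funext fun y => (hΦe y).symm
    rw [this]
    exact (hΦc x).tendsto.comp Filter.tendsto_comap
  · exact he₀.injective (by rw [← hΦe x, ← hΦe y, hxy])
  · exact (hωpos x).ne' (congrFun hx 0)
  · rw [tendsto_pi_nhds]
    intro n
    cases n with
    | zero => exact hω0
    | succ k =>
      refine hω0.zero_mul_isBoundedUnder_le (Filter.isBoundedUnder_of ⟨Real.pi / 2, fun x => ?_⟩)
      exact abs_le.2 ⟨(Real.neg_pi_div_two_lt_arctan _).le, (Real.arctan_lt_pi_div_two _).le⟩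

/-- The maps `j : X → T`, `b : Z → T`, `p : T → Ybar` exhibit `T` as the compactification of `X` by
the boundary `Z` of the compactification `i : Y → Ybar` that makes `f : X → Y` extend
continuously by the identity of `Z`. -/
structure IsBoundaryExtension {X : Type*} {Y : Type*} {Ybar : Type*} {T : Type*}
    [TopologicalSpace X] [TopologicalSpace Ybar] [TopologicalSpace T] (i : Y → Ybar) (Z : Set Ybar)
    (f : X → Y) (j : X → T) (b : Z → T) (p : T → Ybar) : Prop where
  compactSpace : CompactSpace T
  metrizableSpace : TopologicalSpace.MetrizableSpace T
  isOpenEmbedding : IsOpenEmbedding j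
  continuous_proj : Continuous p
  proj_interior : ∀ x, p (j x) = i (f x)
  proj_boundary : ∀ z, p (b z) = z
  cover : ∀ t, (∃ x, j x = t) ∨ ∃ z, b z = t
  nhds_boundary : ∀ z, 𝓝 (b z) = Filter.comap p (𝓝 z)

/-- The disjoint union of a space and a boundary. -/
def BoundarySum (X : Type u) {Ybar : Type w} (Z : Set Ybar) : Type (max u w) := X ⊕ Z

theorem exists_isBoundaryExtension {X : Type u} {Y : Type v} {Ybar : Type w} [MetricSpace X]
    [ProperSpace X] [Nonempty X] [MetricSpace Y] [ProperSpace Y] [TopologicalSpace Ybar]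
    [CompactSpace Ybar] [TopologicalSpace.MetrizableSpace Ybar] {i : Y → Ybar} {Z : Set Ybar}
    (hi : IsOpenEmbedding i) (hZ : range i = Zᶜ) {f : X → Y} (hf : Continuous f)
    (hfp : ∀ K, IsCompact K → IsCompact (f ⁻¹' K)) :
    ∃ (T : Type (max u w)) (_ : TopologicalSpace T) (j : X → T) (b : Z → T) (p : T → Ybar),
      IsBoundaryExtension i Z f j b p := by
  obtain ⟨e, he, he0, het⟩ := exists_isEmbedding_tendsto_zero X
  have hiZ : ∀ y, i y ∉ Z := fun y => hZ.subset ⟨y, rfl⟩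
  have hZc : IsClosed Z := by rw [← isOpen_compl_iff, ← hZ]; exact hi.isOpen_range
  let T := BoundarySum X Z
  let j : X → T := Sum.inl
  let b : Z → T := Sum.inr
  let p : T → Ybar := Sum.elim (i ∘ f) Subtype.val
  let q : T → ℕ → ℝ := Sum.elim e 0
  have hcov : ∀ t : T, (∃ x, j x = t) ∨ ∃ z, b z = t := by
    rintro (x | z)
    exacts [Or.inl ⟨x, rfl⟩, Or.inr ⟨z, rfl⟩]
  -- The map `p` alone may identify points of `X`; `q` separates them and collapses to `0` on the
  -- boundary. Metrizability comes from the ambient product.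
  let τ : TopologicalSpace T := TopologicalSpace.induced (fun t => (p t, q t)) inferInstance
  have hinj : Function.Injective fun t => (p t, q t) := by
    intro s t hst
    obtain ⟨h1, h2⟩ := Prod.mk.inj hst
    rcases hcov s with ⟨x, rfl⟩ | ⟨z, rfl⟩ <;> rcases hcov t with ⟨x', rfl⟩ | ⟨z', rfl⟩
    · rw [he.injective h2]
    · exact absurd h2 (he0 x)
    · exact absurd h2.symm (he0 x')
    · rw [Subtype.ext h1]
  have hemb : IsEmbedding fun t => (p t, q t) := ⟨⟨rfl⟩, hinj⟩
  have hp : Continuous p := continuous_fst.comp hemb.continuous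
  have hq : Continuous q := continuous_snd.comp hemb.continuous
  have hjc : Continuous j := continuous_induced_rng.2
    ((hi.continuous.comp hf).prodMk he.continuous)
  have hje : IsEmbedding j := .of_comp hjc hq he
  have hjr : range j = p ⁻¹' Zᶜ := by
    ext t
    rcases hcov t with ⟨x, rfl⟩ | ⟨z, rfl⟩
    · exact ⟨fun _ => hiZ (f x), fun _ => ⟨x, rfl⟩⟩
    · exact ⟨fun ⟨x, hx⟩ => (Sum.inl_ne_inr hx).elim, fun h => absurd z.2 h⟩
  have hjo : IsOpenEmbedding j := ⟨hje, hjr ▸ hZc.isOpen_compl.preimage hp⟩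
  have hnhds : ∀ z, 𝓝 (b z) = Filter.comap p (𝓝 (z : Ybar)) := by
    intro z
    refine le_antisymm (Filter.tendsto_iff_comap.1 hp.continuousAt) ?_
    rw [hemb.isInducing.nhds_eq_comap, ← Filter.tendsto_iff_comap]
    refine Filter.Tendsto.prodMk_nhds Filter.tendsto_comap ?_
    change Filter.Tendsto q _ (𝓝 0)
    intro U hU
    obtain ⟨K, hK, hKU⟩ := Filter.mem_cocompact.1 (het hU)
    have hKc : IsCompact ((i ∘ f) '' K) := hK.image (hi.continuous.comp hf)
    refine ⟨((i ∘ f) '' K)ᶜ, hKc.isClosed.isOpen_compl.mem_nhds ?_, fun t ht => ?_⟩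
    · rintro ⟨x, -, hx⟩
      exact hiZ (f x) ((show i (f x) = z from hx) ▸ z.2)
    · rcases hcov t with ⟨x, rfl⟩ | ⟨z', rfl⟩
      · exact hKU fun hx => ht ⟨x, hx, rfl⟩
      · exact show (0 : ℕ → ℝ) ∈ U from mem_of_mem_nhds hU
  refine ⟨T, τ, j, b, p, ⟨?_⟩, hemb.metrizableSpace, hjo, hp, fun _ => rfl, fun _ => rfl, hcov,
    hnhds⟩
  -- Push an ultrafilter to `Ybar`. A limit in `Z` lifts by the formula for neighbourhoods; over a
  -- limit in `Y`, properness of `f` traps the ultrafilter in a compact set.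
  rw [isCompact_iff_ultrafilter_le_nhds]
  intro 𝒰 _
  obtain ⟨y, -, hy⟩ := isCompact_iff_ultrafilter_le_nhds.1 (isCompact_univ (X := Ybar)) (𝒰.map p)
    (by simp)
  by_cases hyZ : y ∈ Z
  · refine ⟨b ⟨y, hyZ⟩, mem_univ _, ?_⟩
    rw [hnhds]
    exact Filter.tendsto_iff_comap.1 hy
  · obtain ⟨y, rfl⟩ := hZ.symm.subset hyZ
    have hK := isCompact_closedBall y 1
    have hmem : i '' Metric.closedBall y 1 ∈ 𝓝 (i y) :=
      hi.image_mem_nhds.2 (Metric.closedBall_mem_nhds y one_pos)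
    obtain ⟨t, -, ht⟩ := isCompact_iff_ultrafilter_le_nhds.1 ((hfp _ hK).image hjc) 𝒰 (by
      rw [Filter.le_principal_iff]
      refine Filter.mem_of_superset (hy hmem) ?_
      rintro t ⟨y', hy', hyt⟩
      obtain ⟨x, rfl⟩ : t ∈ range j := by
        rw [hjr, mem_preimage, ← hyt]
        exact hiZ y'
      refine ⟨x, ?_, rfl⟩
      rwa [mem_preimage, ← hi.injective hyt])
    exact ⟨t, mem_univ _, ht⟩

/-! ### Boundary swapping -/

/-- By nullity, all but finitely many translates of a large ball lie inside `V` or miss a smaller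
neighbourhood `V₁`. The exceptional ones occupy a compact subset of `Y`, which can be removed from
`V₁`. -/
theorem IsZStructure.exists_nhds_control {H : Type*} [Group H] {Y : Type*} [MetricSpace Y]
    [MulAction H Y] {Ybar : Type*} [TopologicalSpace Ybar] {i : Y → Ybar} {Z : Set Ybar}
    (hZ : IsZStructure H i Z) (R : ℝ) {z : Ybar} (hz : z ∈ Z) {V : Set Ybar} (hV : V ∈ 𝓝 z) :
    ∃ V' ∈ 𝓝 z, ∀ y y', i y ∈ V' → dist y y' ≤ R → i y' ∈ V := by
  have := hZ.compact
  have := hZ.isAR.metrizable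
  have := hZ.proper
  have := hZ.geometric.isometric
  rcases isEmpty_or_nonempty Y with hY | ⟨⟨y₀⟩⟩
  · exact ⟨V, hV, fun y => hY.elim y⟩
  obtain ⟨r, -, hr⟩ := hZ.geometric.exists_dist_le y₀
  obtain ⟨V₁, hV₁, hV₁c, hV₁V⟩ := exists_mem_nhds_isClosed_subset (interior_mem_nhds.2 hV)
  have hE := hZ.nullity _ (isCompact_closedBall y₀ (r + R)) {interior V, V₁ᶜ}
    (by
      rintro U (rfl | rfl)
      · exact isOpen_interior
      · exact hV₁c.isOpen_compl)
    (by
      rw [sUnion_pair, eq_univ_iff_forall]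
      intro x
      by_cases hx : x ∈ V₁
      · exact Or.inl (hV₁V hx)
      · exact Or.inr hx)
  set E := {h : H | ¬∃ U ∈ ({interior V, V₁ᶜ} : Set (Set Ybar)),
    ∀ x ∈ Metric.closedBall y₀ (r + R), i (h • x) ∈ U} with hEdef
  have hK : IsCompact (i '' ⋃ h ∈ E, Metric.closedBall (h • y₀) r) :=
    (hE.isCompact_biUnion fun h _ => isCompact_closedBall _ _).image hZ.isEmbedding.continuous
  refine ⟨V₁ ∩ (i '' ⋃ h ∈ E, Metric.closedBall (h • y₀) r)ᶜ, Filter.inter_mem hV₁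
    (hK.isClosed.isOpen_compl.mem_nhds ?_), ?_⟩
  · rintro ⟨y, -, rfl⟩
    exact hZ.range_eq.subset ⟨y, rfl⟩ hz
  · rintro y y' ⟨hy1, hy2⟩ hd
    obtain ⟨h, hh⟩ := hr y
    have hnot : h ∉ E := fun hE => hy2 ⟨y, mem_biUnion hE hh, rfl⟩
    obtain ⟨U, hU, hUC⟩ := not_not.1 hnot
    have hmem : ∀ x, dist x y ≤ R → i x ∈ U := by
      intro x hx
      have := hUC (h⁻¹ • x) (by
        rw [Metric.mem_closedBall, ← dist_smul h, smul_inv_smul]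
        linarith [dist_triangle x y (h • y₀)])
      rwa [smul_inv_smul] at this
    rcases hU with rfl | rfl
    · exact interior_subset (hmem y' (by rwa [dist_comm]))
    · exact absurd hy1 (hmem y (by rw [dist_self]; exact dist_nonneg.trans hd))

section

variable {H : Type*} [Group H] {X Y : Type*} [MetricSpace X] [MetricSpace Y] [MulAction H Y]
  {Ybar T : Type*} [TopologicalSpace Ybar] [TopologicalSpace T] {i : Y → Ybar} {Z : Set Ybar}
  {f : X → Y} {j : X → T} {b : Z → T} {p : T → Ybar}

theorem IsZStructure.isOpenEmbedding (hZ : IsZStructure H i Z) : IsOpenEmbedding i :=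
  ⟨hZ.isEmbedding, hZ.range_eq ▸ hZ.isZSet.1.isOpen_compl⟩

theorem IsZStructure.notMem (hZ : IsZStructure H i Z) (y : Y) : i y ∉ Z :=
  hZ.range_eq.subset ⟨y, rfl⟩

theorem IsBoundaryExtension.exists_desc (hT : IsBoundaryExtension i Z f j b p)
    (hZ : IsZStructure H i Z) {α : Type*} (a : X → α) (c : Z → α) :
    ∃ q : T → α, (∀ x, q (j x) = a x) ∧ ∀ z, q (b z) = c z := by
  have h : ∀ t, ∃ y, (∀ x, j x = t → y = a x) ∧ ∀ z, b z = t → y = c z := by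
    intro t
    rcases hT.cover t with ⟨x, rfl⟩ | ⟨z, rfl⟩
    · refine ⟨a x, fun x' hx' => by rw [hT.isOpenEmbedding.injective hx'], fun z hz => ?_⟩
      have := congrArg p hz
      rw [hT.proj_boundary, hT.proj_interior] at this
      exact absurd (this ▸ z.2) (hZ.notMem (f x))
    · refine ⟨c z, fun x hx => ?_, fun z' hz' => ?_⟩
      · have := congrArg p hx
        rw [hT.proj_boundary, hT.proj_interior] at this
        exact absurd (this ▸ z.2) (hZ.notMem (f x))
      · have := congrArg p hz'
        rw [hT.proj_boundary, hT.proj_boundary] at this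
        rw [Subtype.ext this]
  choose q hq using h
  exact ⟨q, fun x => (hq _).1 x rfl, fun z => (hq _).2 z rfl⟩

/-- Continuity at `Z` may be tested after `p`, where the map becomes `f ∘ f'`, a bounded move. -/
theorem IsBoundaryExtension.exists_continuous_inverse (hT : IsBoundaryExtension i Z f j b p)
    (hZ : IsZStructure H i Z) {f' : Y → X} (hf' : Continuous f') {c : ℝ}
    (hff' : ∀ y, dist (f (f' y)) y ≤ c) :
    ∃ q : Ybar → T, Continuous q ∧ (∀ y, q (i y) = j (f' y)) ∧ ∀ z : Z, q z = b z := by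
  classical
  have hex : ∀ y, ∃ t, (∀ y', i y' = y → t = j (f' y')) ∧ ∀ z : Z, z = y → t = b z := by
    intro y
    by_cases hy : y ∈ Z
    · refine ⟨b ⟨y, hy⟩, fun y' hy' => absurd (hy' ▸ hy) (hZ.notMem y'), ?_⟩
      rintro z rfl
      rfl
    · obtain ⟨y, rfl⟩ := hZ.range_eq.symm.subset hy
      refine ⟨j (f' y), fun y' hy' => by rw [hZ.isEmbedding.injective hy'], fun z hz => ?_⟩
      exact absurd (hz ▸ z.2) hy
  choose q hq using hex
  have hqi : ∀ y, q (i y) = j (f' y) := fun y => (hq _).1 y rfl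
  have hqz : ∀ z : Z, q z = b z := fun z => (hq _).2 z rfl
  refine ⟨q, continuous_iff_continuousAt.2 fun y => ?_, hqi, hqz⟩
  by_cases hy : y ∈ Z
  · rw [ContinuousAt, hqz ⟨y, hy⟩, hT.nhds_boundary, Filter.tendsto_comap_iff]
    intro V hV
    obtain ⟨V', hV', hVV⟩ := hZ.exists_nhds_control c hy hV
    rw [Filter.mem_map]
    filter_upwards [hV, hV'] with t ht ht'
    by_cases htZ : t ∈ Z
    · rw [mem_preimage, Function.comp_apply, hqz ⟨t, htZ⟩, hT.proj_boundary]
      exact ht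
    · obtain ⟨y', rfl⟩ := hZ.range_eq.symm.subset htZ
      rw [mem_preimage, Function.comp_apply, hqi, hT.proj_interior]
      exact hVV _ _ ht' (by rw [dist_comm]; exact hff' y')
  · obtain ⟨y, rfl⟩ := hZ.range_eq.symm.subset hy
    rw [← hZ.isOpenEmbedding.continuousAt_iff]
    have : q ∘ i = j ∘ f' := funext hqi
    rw [this]
    exact (hT.isOpenEmbedding.continuous.comp hf').continuousAt

/-- Only the uniform bound on `k` matters at the boundary, so its dependence on `s` may degenerate
there. -/
theorem IsBoundaryExtension.exists_continuous_homotopy (hT : IsBoundaryExtension i Z f j b p)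
    (hZ : IsZStructure H i Z) (hfb : IsBornologous f) {L : Type*} [TopologicalSpace L]
    {k : X × L → X} (hk : Continuous k) {c : ℝ} (hkc : ∀ x s, dist (k (x, s)) x ≤ c) :
    ∃ K : T × L → T, Continuous K ∧ (∀ x s, K (j x, s) = j (k (x, s))) ∧
      ∀ z s, K (b z, s) = b z := by
  obtain ⟨κ, hκj, hκb⟩ := hT.exists_desc hZ (fun x (s : L) => j (k (x, s))) fun z _ => b z
  obtain ⟨c', hc'⟩ := hfb c
  refine ⟨fun q => κ q.1 q.2, continuous_iff_continuousAt.2 ?_, fun x s => by simp only [hκj],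
    fun z s => by simp only [hκb]⟩
  rintro ⟨t, s⟩
  rcases hT.cover t with ⟨x, rfl⟩ | ⟨z, rfl⟩
  · have ho := hT.isOpenEmbedding.prodMap (IsOpenEmbedding.id (X := L))
    rw [show (j x, s) = Prod.map j id (x, s) from rfl, ← ho.continuousAt_iff]
    have : (fun q : T × L => κ q.1 q.2) ∘ Prod.map j id = j ∘ k := by
      funext q
      simp [hκj]
    rw [this]
    exact (hT.isOpenEmbedding.continuous.comp hk).continuousAt
  · rw [ContinuousAt, hκb, hT.nhds_boundary, Filter.tendsto_comap_iff]
    intro V hV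
    obtain ⟨V', hV', hVV⟩ := hZ.exists_nhds_control c' z.2 hV
    have hp : Filter.Tendsto (fun q : T × L => p q.1) (𝓝 (b z, s)) (𝓝 (z : Ybar)) := by
      have := (hT.continuous_proj.comp continuous_fst).tendsto (b z, s)
      rwa [Function.comp_apply, hT.proj_boundary] at this
    rw [Filter.mem_map]
    filter_upwards [hp hV, hp hV']
    rintro ⟨t, s'⟩ ht ht'
    rcases hT.cover t with ⟨x, rfl⟩ | ⟨z', rfl⟩
    · have ht' : i (f x) ∈ V' := by simpa [hT.proj_interior] using ht'
      simp only [mem_preimage, Function.comp_apply, hκj, hT.proj_interior]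
      exact hVV _ _ ht' (hc' _ _ (by rw [dist_comm]; exact hkc x s'))
    · simpa [hκb] using ht

theorem IsBoundaryExtension.exists_homotopy_off_boundary (hT : IsBoundaryExtension i Z f j b p)
    (hZ : IsZStructure H i Z) (hfb : IsBornologous f) {f' : Y → X} (hf' : Continuous f') {c : ℝ}
    (hff' : ∀ y, dist (f (f' y)) y ≤ c) {h : X × unitInterval → X} (hh : Continuous h)
    (hh0 : ∀ x, h (x, 0) = x) (hh1 : ∀ x, h (x, 1) = f' (f x))
    (hhc : ∀ x s, dist (h (x, s)) x ≤ c) :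
    ∃ K : T × unitInterval → T, Continuous K ∧ (∀ t, K (t, 0) = t) ∧
      ∀ t s, 0 < s → K (t, s) ∈ range j := by
  have := hZ.isAR.metrizable
  obtain ⟨F, hF, hF0, hFZ⟩ := hZ.isZSet.2
  obtain ⟨q, hq, hqi, hqz⟩ := hT.exists_continuous_inverse hZ hf' hff'
  obtain ⟨δ', hδ', hδ'Z, hδ'nn⟩ : ∃ δ : Ybar → ℝ, Continuous δ ∧ (∀ y, δ y = 0 ↔ y ∈ Z) ∧
      ∀ y, 0 ≤ δ y := by
    let := TopologicalSpace.metrizableSpaceMetric Ybar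
    -- `Metric.infDist` to the empty set is `0`, so an empty boundary needs another `δ`.
    rcases Z.eq_empty_or_nonempty with rfl | hne
    · exact ⟨fun _ => 1, continuous_const, by simp, fun _ => zero_le_one⟩
    · exact ⟨fun y => Metric.infDist y Z, Metric.continuous_infDist_pt Z,
        fun y => (hZ.isZSet.1.mem_iff_infDist_zero hne).symm, fun y => Metric.infDist_nonneg⟩
  let δ : T → ℝ := fun t => δ' (p t)
  have hδ : Continuous δ := hδ'.comp hT.continuous_proj
  have hδj : ∀ x, 0 < δ (j x) := fun x => lt_of_le_of_ne (hδ'nn _) fun h0 => by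
    have := (hδ'Z _).1 h0.symm
    rw [hT.proj_interior] at this
    exact hZ.notMem _ this
  have hδb : ∀ z, δ (b z) = 0 := fun z => (hδ'Z _).2 (by rw [hT.proj_boundary]; exact z.2)
  -- Run `h` at speed `1 / δ`, so that it ends at `s = δ t`. The speed blows up at the boundary,
  -- which boundedness of `h` makes harmless.
  obtain ⟨K₁, hK₁, hK₁j, hK₁b⟩ := hT.exists_continuous_homotopy hZ hfb (L := unitInterval)
    (k := fun y => h (y.1, projIcc 0 1 zero_le_one ((y.2 : ℝ) / δ (j y.1))))
    (hh.comp (continuous_fst.prodMk (continuous_projIcc.comp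
      ((continuous_subtype_val.comp continuous_snd).div
        (hδ.comp (hT.isOpenEmbedding.continuous.comp continuous_fst)) fun y => (hδj y.1).ne'))))
    fun x s => hhc x _
  let K₂ : T × unitInterval → T := fun y =>
    q (F (p y.1, projIcc 0 1 zero_le_one ((y.2 : ℝ) - δ y.1)))
  have hK₂ : Continuous K₂ := hq.comp (hF.comp ((hT.continuous_proj.comp continuous_fst).prodMk
    (continuous_projIcc.comp ((continuous_subtype_val.comp continuous_snd).sub
      (hδ.comp continuous_fst)))))
  have hqr : ∀ y, y ∉ Z → q y ∈ range j := by
    intro y hy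
    obtain ⟨y, rfl⟩ := hZ.range_eq.symm.subset hy
    exact ⟨f' y, (hqi y).symm⟩
  classical
  refine ⟨fun y => if (y.2 : ℝ) ≤ δ y.1 then K₁ y else K₂ y,
    Continuous.if_le hK₁ hK₂ (continuous_subtype_val.comp continuous_snd)
      (hδ.comp continuous_fst) ?_, fun t => ?_, fun t s hs => ?_⟩
  · rintro ⟨t, s⟩ hs
    have hs : (s : ℝ) = δ t := hs
    have h2 : K₂ (t, s) = q (p t) := by
      simp only [K₂, hs, sub_self, projIcc_left]
      exact congrArg q (hF0 _)
    rw [h2]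
    rcases hT.cover t with ⟨x, rfl⟩ | ⟨z, rfl⟩
    · rw [hK₁j, hT.proj_interior, hqi]
      simp only [hs, div_self (hδj x).ne', projIcc_right]
      exact congrArg j (hh1 x)
    · rw [hK₁b, hT.proj_boundary, hqz]
  · have h0 : ((0 : unitInterval) : ℝ) ≤ δ t := hδ'nn _
    simp only [if_pos h0]
    rcases hT.cover t with ⟨x, rfl⟩ | ⟨z, rfl⟩
    · rw [hK₁j]
      simp only [Icc.coe_zero, zero_div, projIcc_left]
      exact congrArg j (hh0 x)
    · exact hK₁b z 0
  · dsimp only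
    split_ifs with hle
    · rcases hT.cover t with ⟨x, rfl⟩ | ⟨z, rfl⟩
      · exact ⟨_, (hK₁j x s).symm⟩
      -- On the boundary `δ` vanishes, so at positive times only the second phase `K₂` applies.
      · rw [hδb] at hle
        exact absurd (Subtype.coe_lt_coe.2 hs) (not_lt.2 hle)
    · refine hqr _ (hFZ _ _ ?_)
      rw [← Subtype.coe_lt_coe, coe_projIcc]
      exact lt_max_of_lt_right (lt_min zero_lt_one (sub_pos.2 (not_le.1 hle)))

/-- If `g • x₀` is near the boundary, bounded control puts all of `g • C` in one member of the
cover. The other `g` keep `g • x₀` in a compact subset of `X`, so they are finitely many. -/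
theorem IsBoundaryExtension.nullity [ProperSpace X] {G : Type*} [Group G] [MulAction G X]
    (hT : IsBoundaryExtension i Z f j b p) (hZ : IsZStructure H i Z) (hfb : IsBornologous f)
    (hG : IsGeometricAction G X) {C : Set X} (hC : IsCompact C) {𝒰 : Set (Set T)}
    (h𝒰 : ∀ U ∈ 𝒰, IsOpen U) (hcov : ⋃₀ 𝒰 = univ) [Nonempty X] :
    {g : G | ¬ ∃ U ∈ 𝒰, ∀ x ∈ C, j (g • x) ∈ U}.Finite := by
  have := hT.compactSpace
  have := hG.isometric
  obtain ⟨x₀⟩ := ‹Nonempty X›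
  obtain ⟨r, hr⟩ := hC.isBounded.subset_closedBall x₀
  obtain ⟨R, hR⟩ := hfb r
  have hz : ∀ z : Z, ∃ U ∈ 𝒰, ∃ V : Set Ybar, IsOpen V ∧ (z : Ybar) ∈ V ∧
      ∀ x x', p (j x) ∈ V → dist x x' ≤ r → j x' ∈ U := by
    intro z
    obtain ⟨U, hU, hzU⟩ := mem_sUnion.1 (hcov.symm.subset (mem_univ (b z)))
    have hn := (h𝒰 U hU).mem_nhds hzU
    rw [hT.nhds_boundary] at hn
    obtain ⟨V, hV, hVU⟩ := hn
    obtain ⟨V', hV', hVV⟩ := hZ.exists_nhds_control R z.2 hV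
    refine ⟨U, hU, interior V', isOpen_interior, mem_interior_iff_mem_nhds.2 hV',
      fun x x' hx hd => hVU ?_⟩
    rw [hT.proj_interior] at hx
    rw [mem_preimage, hT.proj_interior]
    exact hVV _ _ (interior_subset hx) (hR _ _ hd)
  choose U hU V hVo hzV hVU using hz
  have hKc : IsClosed (⋂ z, (p ⁻¹' V z)ᶜ) :=
    isClosed_iInter fun z => ((hVo z).preimage hT.continuous_proj).isClosed_compl
  have hKj : (⋂ z, (p ⁻¹' V z)ᶜ) ⊆ range j := by
    intro t ht
    rcases hT.cover t with ⟨x, rfl⟩ | ⟨z, rfl⟩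
    · exact ⟨x, rfl⟩
    · refine absurd ?_ (mem_iInter.1 ht z)
      rw [mem_preimage, hT.proj_boundary]
      exact hzV z
  have hK : IsCompact (j ⁻¹' ⋂ z, (p ⁻¹' V z)ᶜ) :=
    hT.isOpenEmbedding.isInducing.isCompact_preimage' hKc.isCompact hKj
  obtain ⟨s, hs⟩ := hK.isBounded.subset_closedBall x₀
  refine (hG.finite_dist_le x₀ x₀ s).subset fun g hg => hs ?_
  by_contra hgK
  rw [mem_preimage, mem_iInter, not_forall] at hgK
  obtain ⟨z, hz⟩ := hgK
  refine hg ⟨U z, hU z, fun x hx => hVU z (g • x₀) _ (not_not.1 hz) ?_⟩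
  rw [dist_smul, dist_comm]
  exact hr hx

theorem IsBoundaryExtension.range_interior (hT : IsBoundaryExtension i Z f j b p)
    (hZ : IsZStructure H i Z) : range j = (range b)ᶜ := by
  ext t
  constructor
  · rintro ⟨x, rfl⟩ ⟨z, hz⟩
    have := congrArg p hz
    rw [hT.proj_boundary, hT.proj_interior] at this
    exact hZ.notMem (f x) (this ▸ z.2)
  · exact fun ht => (hT.cover t).resolve_right ht

end

theorem IsBoundaryExtension.isEmbedding_boundary {X Y Ybar T : Type*} [TopologicalSpace X]
    [TopologicalSpace Ybar] [TopologicalSpace T] {i : Y → Ybar} {Z : Set Ybar} {f : X → Y}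
    {j : X → T} {b : Z → T} {p : T → Ybar} (hT : IsBoundaryExtension i Z f j b p) :
    IsEmbedding b := by
  have hpb : p ∘ b = Subtype.val := funext hT.proj_boundary
  refine .of_comp (continuous_iff_continuousAt.2 fun z => ?_) hT.continuous_proj
    (hpb ▸ IsEmbedding.subtypeVal)
  rw [ContinuousAt, hT.nhds_boundary, Filter.tendsto_comap_iff, hpb]
  exact continuous_subtype_val.continuousAt

/-- The coarse inverse `f'` bounds the diameter of the preimage. -/
theorem IsBornologous.isCompact_preimage {X Y : Type*} [MetricSpace X] [MetricSpace Y]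
    [ProperSpace X] {f : X → Y} (hf : Continuous f) {f' : Y → X} (hf' : IsBornologous f') {c : ℝ}
    (hc : ∀ x, dist (f' (f x)) x ≤ c) {K : Set Y} (hK : IsCompact K) : IsCompact (f ⁻¹' K) := by
  refine Metric.isCompact_of_isClosed_isBounded (hK.isClosed.preimage hf) ?_
  obtain ⟨R, hR⟩ := Metric.isBounded_iff.1 hK.isBounded
  obtain ⟨R', hR'⟩ := hf' R
  refine Metric.isBounded_iff.2 ⟨c + R' + c, fun x hx x' hx' => ?_⟩
  linarith [dist_triangle4 x (f' (f x)) (f' (f x')) x', dist_comm x (f' (f x)), hc x, hc x',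
    hR' _ _ (hR hx hx')]

theorem theorem1p4 {G H : Type*} {X : Type u} {Y : Type v} {Ybar : Type w}
    [Group G] [Group H]
    [MetricSpace X] [ProperSpace X] [MetricSpace Y] [ProperSpace Y]
    [MulAction G X] [MulAction H Y] [TopologicalSpace Ybar]
    (hGH : QuasiIsometricGroups G H)
    (hX : IsAR X) (hY : IsAR Y)
    (hGX : IsGeometricAction G X) (hHY : IsGeometricAction H Y)
    (i : Y → Ybar) (Z : Set Ybar) (hZ : IsZStructure H i Z) :
    ∃ (Xbar : Type (max u w)) (_ : TopologicalSpace Xbar) (j : X → Xbar) (Z' : Set Xbar),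
      IsZStructure G j Z' ∧ Nonempty (Z' ≃ₜ Z) := by
  have := hX.nonempty
  have := hZ.compact
  have := hZ.isAR.metrizable
  obtain ⟨f, f', h, c, hf, hf', hh, hfb, hfb', hf'f, hff', hh0, hh1, hhc⟩ :=
    hGH.exists_continuous_equivalence hX hY hGX hHY
  obtain ⟨T, τ, j, b, p, hT⟩ := exists_isBoundaryExtension hZ.isOpenEmbedding hZ.range_eq hf
    fun K hK => IsBornologous.isCompact_preimage hf hfb' hf'f hK
  obtain ⟨K, hK, hK0, hKj⟩ :=
    hT.exists_homotopy_off_boundary hZ hfb hf' hff' hh hh0 hh1 hhc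
  have := hT.compactSpace
  have := hT.metrizableSpace
  have hr := hT.range_interior hZ
  refine ⟨T, τ, j, range b, ⟨inferInstance,
    hX.of_homotopy hT.isOpenEmbedding.isEmbedding hK hK0 hKj, ⟨?_, K, hK, hK0, fun t s hs => ?_⟩,
    hT.isOpenEmbedding.isEmbedding, hr, inferInstance, hGX,
    fun C hC 𝒰 h𝒰 hcov => hT.nullity hZ hfb hGX hC h𝒰 hcov⟩,
    ⟨hT.isEmbedding_boundary.toHomeomorph.symm⟩⟩
  · rw [← isOpen_compl_iff, ← hr]
    exact hT.isOpenEmbedding.isOpen_range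
  · have := hKj t s hs
    rwa [hr] at this
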